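/- Let $g\ge 2$ and $m\ge 1$ be integers, let $$\pi_1(\Sigma_g)=\langle x_1,\dots,x_{2g}\mid [x_1,x_2]\cdots[x_{2g-1},x_{2g}]\rangle,\qquad [a,b]=aba^{-1}b^{-1},$$ be the canonical presentation of the fundamental group of the closed orientable surface $\Sigma_g$ of genus $g$, and let $G=\pi_1(\Sigma_g)\times\mathbb{Z}^m$. Write $t_1,\dots,t_m$ for the standard basis of the factor $\mathbb{Z}^m$ (written multiplicatively), so that every element of $G$ is uniquely $u\,\mathbf{t}^{\mathbf a}=u\,t_1^{a_1}\cdots t_m^{a_m}$ with $u\in\pi_1(\Sigma_g)$ and a row vector $\mathbf a=(a_1,\dots,a_m)\in\mathbb{Z}^m$. For $u\in\pi_1(\Sigma_g)$ let the row vector $\mathbf u\in\mathbb{Z}^{2g}$ be its abelianization, i.e. the image of $u$ under the homomorphism $\pi_1(\Sigma_g)\to\mathbb{Z}^{2g}$ that sends $x_i$ to the $i$-th standard basis vector. Then every endomorphism $\Psi$ of $G$ has one of the following two forms: 1. $\Psi(u\,\mathbf t^{\mathbf a})=\phi(u)\,\mathbf t^{\mathbf a\mathbf Q+\mathbf u\mathbf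 P}$ for all $u\in\pi_1(\Sigma_g)$, $\mathbf a\in\mathbb{Z}^m$, where $\phi$ is an endomorphism of $\pi_1(\Sigma_g)$, $\mathbf Q\in\mathcal M_{m\times m}(\mathbb{Z})$ and $\mathbf P\in\mathcal M_{2g\times m}(\mathbb{Z})$; 2. $\Psi(u\,\mathbf t^{\mathbf a})=z^{\mathbf a\mathbf l^T+\mathbf u\mathbf h^T}\,\mathbf t^{\mathbf a\mathbf Q+\mathbf u\mathbf P}$ for all $u\in\pi_1(\Sigma_g)$, $\mathbf a\in\mathbb{Z}^m$, where $1\ne z\in\pi_1(\Sigma_g)$ is not a proper power (that is, $z\neq w^k$ for all $w\in\pi_1(\Sigma_g)$ and $k\ge 2$), $\mathbf Q\in\mathcal M_{m\times m}(\mathbb{Z})$, $\mathbf P\in\mathcal M_{2g\times m}(\mathbb{Z})$, $\mathbf 0\ne\mathbf l\in\mathbb{Z}^m$ and $\mathbf h\in\mathbb{Z}^{2g}$. -/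

import Mathlib

/-- The surface relator `[x₁, x₂][x₃, x₄] ⋯ [x_{2g-1}, x_{2g}]`, with `[a, b] = a b a⁻¹ b⁻¹`,
as a word in the free group on `2g` letters (indexed from `0`). -/
def surfaceRelator (g : ℕ) : FreeGroup (Fin (2 * g)) :=
  (List.ofFn fun i : Fin g =>
    let a : FreeGroup (Fin (2 * g)) := FreeGroup.of ⟨2 * i.val, by omega⟩
    let b : FreeGroup (Fin (2 * g)) := FreeGroup.of ⟨2 * i.val + 1, by omega⟩
    a * b * a⁻¹ * b⁻¹).prod

/-- The fundamental group of the closed orientable surface of genus `g`, through its canonical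
presentation `⟨x₁, …, x_{2g} ∣ [x₁, x₂] ⋯ [x_{2g-1}, x_{2g}]⟩`. -/
abbrev SurfaceGroup (g : ℕ) : Type :=
  PresentedGroup ({surfaceRelator g} : Set (FreeGroup (Fin (2 * g))))

/-- The group `π₁(Σ_g) × ℤ^m`; the element `u t^a` is the pair `(u, Multiplicative.ofAdd a)`. -/
abbrev SurfaceTimesFreeAbelian (g m : ℕ) : Type :=
  SurfaceGroup g × Multiplicative (Fin m → ℤ)

/-- A homomorphism from the free group to a commutative group kills the surface relator. -/
theorem lift_surfaceRelator {A : Type*} [CommGroup A] (g : ℕ) (f : Fin (2 * g) → A) :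
    ∀ r ∈ ({surfaceRelator g} : Set (FreeGroup (Fin (2 * g)))), FreeGroup.lift f r = 1 := by
  intro r hr
  rw [Set.mem_singleton_iff.mp hr, surfaceRelator, map_list_prod]
  apply List.prod_eq_one
  intro x hx
  simp only [List.mem_map, List.mem_ofFn] at hx
  obtain ⟨y, ⟨i, rfl⟩, rfl⟩ := hx
  simp only [map_mul, map_inv]
  rw [mul_comm (FreeGroup.lift f _) (FreeGroup.lift f _), mul_inv_cancel_right, mul_inv_cancel]

/-- The abelianization homomorphism `π₁(Σ_g) → ℤ^{2g}`, which sends `x_i` to the `i`-th standard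
basis vector. -/
def surfaceAbHom (g : ℕ) : SurfaceGroup g →* Multiplicative (Fin (2 * g) → ℤ) :=
  PresentedGroup.toGroup
    (lift_surfaceRelator g fun i => Multiplicative.ofAdd (Pi.single i (1 : ℤ)))

/-- The exponent vector in `ℤ^{2g}` of an element of `π₁(Σ_g)`. -/
def surfaceAb {g : ℕ} (u : SurfaceGroup g) : Fin (2 * g) → ℤ :=
  Multiplicative.toAdd (surfaceAbHom g u)

/-- `z` is a proper power if `z = w ^ k` for some element `w` and some `k ≥ 2`. -/
def IsProperPower {G : Type*} [Group G] (z : G) : Prop :=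
  ∃ (w : G) (k : ℕ), 2 ≤ k ∧ z = w ^ k

/-! Each `t^a` is central, so its image commutes with the whole image of `Ψ`. If every `Ψ(t^a)` has
trivial surface component, form 1 holds. Otherwise some component `w ≠ 1` occurs, and the surface
component of `Ψ` takes values in the centralizer of `w`. For genus at least 2 this centralizer is
infinite cyclic, generated by some `z` that is not a proper power. The exponents are homomorphisms
to free abelian groups, hence linear.

Cyclicity (`SurfaceGroup.isCyclic_centralizer`) is proved algebraically. With `r` the relator in the
letters after the second, the relation reads `x₁ x₂ x₁⁻¹ = r⁻¹ x₂`. This embeds the group in `F ⋊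
ℤ`, where `F` is free on a stem `x₂` and on the conjugates of the remaining letters by `x₁ ^ i`
(level `i`). Centralizers in `F` are cyclic, and `eq_one_of_commute_inl` shows that nothing outside
`F` commutes with a nontrivial element of `F`. The latter needs `r ≠ 1`, that is, genus at least 2.
-/

/-! ### Centralizers in free groups -/

namespace FreeGroup

/-- A free group on at least two letters has trivial center. -/
theorem eq_one_of_forall_commute_of {α : Type*} [Nontrivial α] {a : FreeGroup α}
    (h : ∀ x, Commute a (of x)) : a = 1 := by
  classical
  by_contra ha
  have hw : a.toWord ≠ [] := fun h' => ha (toWord_eq_nil_iff.mp h')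
  obtain ⟨w, p, hwp⟩ : ∃ w p, a.toWord = w ++ [p] :=
    ⟨_, _, (List.dropLast_append_getLast hw).symm⟩
  -- With `x` different from the last letter of `a`, the word `a x` is reduced and ends in `x`,
  -- while `x a` either gets shorter or still ends in `p`.
  obtain ⟨x, hx⟩ := exists_ne p.1
  have hred : IsReduced (w ++ [p]) := hwp ▸ isReduced_toWord
  have hright : (a * of x).toWord = w ++ [p] ++ [(x, true)] := by
    rw [toWord_mul, toWord_of, hwp]
    refine IsReduced.reduce_eq ?_
    refine IsReduced.append_overlap hred ?_ (by simp)
    simp [IsReduced, hx.symm]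
  have hleft : (of x * a).toWord = reduce ((x, true) :: (w ++ [p])) := by
    rw [toWord_mul, toWord_of, hwp]
    rfl
  rw [(h x).eq, hleft, reduce.cons, hred.reduce_eq] at hright
  cases hwp' : w ++ [p] with
  | nil => simp at hwp'
  | cons q t =>
    rw [hwp'] at hright
    simp only at hright
    split_ifs at hright
    · have := congrArg List.length hright
      simp only [List.length_append, List.length_cons, List.length_nil] at this
      omega
    · rw [← hwp', ← List.cons_append] at hright
      have := congrArg List.getLast? hright
      rw [List.getLast?_concat, List.getLast?_concat, Option.some.injEq] at this
      exact hx (by rw [this])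

/-- A free group on at most one letter is cyclic. -/
theorem isCyclic_of_subsingleton (α : Type*) [Subsingleton α] : IsCyclic (FreeGroup α) := by
  rcases isEmpty_or_nonempty α with _ | ⟨⟨x⟩⟩
  · infer_instance
  · refine ⟨of x, fun a => ?_⟩
    change a ∈ Subgroup.zpowers (of x)
    induction a using FreeGroup.induction_on with
    | C1 => exact one_mem _
    | of y => rw [Subsingleton.elim y x]; exact Subgroup.mem_zpowers _
    | inv_of y hy => exact inv_mem hy
    | mul a b ha hb => exact mul_mem ha hb

/-- The centralizer of a nontrivial element of a free group is cyclic. -/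
theorem isCyclic_centralizer {α : Type*} {a : FreeGroup α} (ha : a ≠ 1) :
    IsCyclic (Subgroup.centralizer {a}) := by
  -- By Nielsen–Schreier the centralizer is free. It has `a` in its center, so its rank is at most
  -- one.
  let e := IsFreeGroup.toFreeGroup (Subgroup.centralizer {a})
  have hc : Subsingleton (IsFreeGroup.Generators (Subgroup.centralizer {a})) := by
    by_contra hn
    rw [not_subsingleton_iff_nontrivial] at hn
    let a' : Subgroup.centralizer {a} := ⟨a, Subgroup.mem_centralizer_singleton_iff.mpr rfl⟩
    have h1 : e a' = 1 := by
      refine eq_one_of_forall_commute_of fun x => ?_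
      have : Commute a' (e.symm (of x)) :=
        Subtype.ext (Subgroup.mem_centralizer_singleton_iff.mp (e.symm (of x)).2).symm
      simpa using this.map e
    rw [map_eq_one_iff e e.injective] at h1
    exact ha (congrArg Subtype.val h1)
  have := isCyclic_of_subsingleton (IsFreeGroup.Generators (Subgroup.centralizer {a}))
  exact isCyclic_of_injective e.toMonoidHom e.injective

end FreeGroup

/-! ### A mapping torus of a free group -/

namespace FreeMappingTorus

variable {J : Type*}

/-- The copy at level `i` of the letters `J` among the letters `Option (J × ℤ)`. -/
def level (J : Type*) (i : ℤ) : FreeGroup J →* FreeGroup (Option (J × ℤ)) :=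
  FreeGroup.map fun j => some (j, i)

/-- The letter outside all levels. -/
def stem (J : Type*) : FreeGroup (Option (J × ℤ)) := FreeGroup.of none

/-- The endomorphism that moves all levels by `k` and multiplies the stem by `c` on the left. -/
def shiftHom (k : ℤ) (c : FreeGroup (Option (J × ℤ))) :
    FreeGroup (Option (J × ℤ)) →* FreeGroup (Option (J × ℤ)) :=
  FreeGroup.lift fun o => o.elim (c * stem J) fun p => FreeGroup.of (some (p.1, p.2 + k))

@[simp] theorem shiftHom_stem (k : ℤ) (c : FreeGroup (Option (J × ℤ))) :
    shiftHom k c (stem J) = c * stem J := by simp [shiftHom, stem]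

@[simp] theorem shiftHom_level (k : ℤ) (c : FreeGroup (Option (J × ℤ))) (i : ℤ)
    (x : FreeGroup J) : shiftHom k c (level J i x) = level J (i + k) x := by
  have : (shiftHom k c).comp (level J i) = level J (i + k) := by
    ext j; simp [shiftHom, level]
  exact DFunLike.congr_fun this x

theorem hom_ext {M : Type*} [Monoid M] {f f' : FreeGroup (Option (J × ℤ)) →* M}
    (hs : f (stem J) = f' (stem J))
    (hl : ∀ i j, f (level J i (FreeGroup.of j)) = f' (level J i (FreeGroup.of j))) : f = f' := by
  ext (_ | ⟨j, i⟩)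
  · exact hs
  · simpa [level] using hl i j

/-- The automorphism that moves all levels up by one and sends the stem `y` to `r₀⁻¹ y`, where `r₀`
is the copy of `r` at level `0`. -/
def shift (r : FreeGroup J) : MulAut (FreeGroup (Option (J × ℤ))) :=
  -- The inverse uses level `-1` because that copy of `r` moves up to level `0` and cancels `r₀⁻¹`.
  MonoidHom.toMulEquiv (shiftHom 1 (level J 0 r)⁻¹) (shiftHom (-1) (level J (-1) r))
    (hom_ext (by simp) (by simp)) (hom_ext (by simp) (by simp))

@[simp] theorem shift_stem (r : FreeGroup J) : shift r (stem J) = (level J 0 r)⁻¹ * stem J :=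
  shiftHom_stem _ _

@[simp] theorem shift_level (r : FreeGroup J) (i : ℤ) (x : FreeGroup J) :
    shift r (level J i x) = level J (i + 1) x := shiftHom_level _ _ _ _

theorem shift_pow_level (r : FreeGroup J) (n : ℕ) (i : ℤ) (x : FreeGroup J) :
    (shift r ^ n) (level J i x) = level J (i + n) x := by
  induction n generalizing i with
  | zero => simp
  | succ n ih => rw [pow_succ, MulAut.mul_apply, shift_level, ih, Nat.cast_succ, add_assoc,
      add_comm (1 : ℤ)]

theorem shift_pow_succ_stem (r : FreeGroup J) (n : ℕ) :
    (shift r ^ (n + 1)) (stem J) = (level J n r)⁻¹ * (shift r ^ n) (stem J) := by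
  rw [pow_succ, MulAut.mul_apply, shift_stem, map_mul, map_inv, shift_pow_level, zero_add]

/-- The exponent sum of the stem. -/
def stemExponent (J : Type*) : FreeGroup (Option (J × ℤ)) →* Multiplicative ℤ :=
  FreeGroup.lift fun o => o.elim (Multiplicative.ofAdd 1) 1

@[simp] theorem stemExponent_stem : stemExponent J (stem J) = Multiplicative.ofAdd 1 := by
  simp [stemExponent, stem]

@[simp] theorem stemExponent_level (i : ℤ) (x : FreeGroup J) :
    stemExponent J (level J i x) = 1 := by
  have : (stemExponent J).comp (level J i) = 1 := by ext j; simp [stemExponent, level]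
  exact DFunLike.congr_fun this x

/-- The projection onto level `i` that kills the stem and all other levels. -/
def proj (J : Type*) (i : ℤ) : FreeGroup (Option (J × ℤ)) →* FreeGroup J :=
  FreeGroup.lift fun o => o.elim 1 fun p => if p.2 = i then FreeGroup.of p.1 else 1

@[simp] theorem proj_stem (i : ℤ) : proj J i (stem J) = 1 := by simp [proj, stem]

@[simp] theorem proj_level_self (i : ℤ) (x : FreeGroup J) : proj J i (level J i x) = x := by
  have : (proj J i).comp (level J i) = MonoidHom.id _ := by ext j; simp [proj, level]
  exact DFunLike.congr_fun this x

theorem proj_level_of_ne {i k : ℤ} (h : k ≠ i) (x : FreeGroup J) :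
    proj J i (level J k x) = 1 := by
  have : (proj J i).comp (level J k) = 1 := by ext j; simp [proj, level, h]
  exact DFunLike.congr_fun this x

/-- The retraction that kills the levels outside `[-M, M]`. -/
def trunc (J : Type*) (M : ℕ) : FreeGroup (Option (J × ℤ)) →* FreeGroup (Option (J × ℤ)) :=
  FreeGroup.lift fun o => o.elim (stem J)
    fun p => if |p.2| ≤ M then FreeGroup.of (some p) else 1

@[simp] theorem trunc_stem (M : ℕ) : trunc J M (stem J) = stem J := by simp [trunc, stem]

theorem trunc_level_of_le {M : ℕ} {i : ℤ} (h : |i| ≤ M) (x : FreeGroup J) :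
    trunc J M (level J i x) = level J i x := by
  have : (trunc J M).comp (level J i) = level J i := by ext j; simp [trunc, level, h]
  exact DFunLike.congr_fun this x

theorem trunc_level_of_lt {M : ℕ} {i : ℤ} (h : (M : ℤ) < |i|) (x : FreeGroup J) :
    trunc J M (level J i x) = 1 := by
  have : (trunc J M).comp (level J i) = 1 := by ext j; simp [trunc, level, not_le.mpr h]
  exact DFunLike.congr_fun this x

/-- A word meets only finitely many levels. Quantifying over all `N ≥ M` lets the bounds of two
factors be merged. -/
theorem exists_trunc_eq_self (a : FreeGroup (Option (J × ℤ))) :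
    ∃ M : ℕ, ∀ N ≥ M, trunc J N a = a := by
  induction a using FreeGroup.induction_on with
  | C1 => exact ⟨0, by simp⟩
  | of o =>
    rcases o with _ | ⟨j, i⟩
    · exact ⟨0, fun N _ => trunc_stem N⟩
    · refine ⟨i.natAbs, fun N hN => ?_⟩
      have : |i| ≤ N := by rw [Int.abs_eq_natAbs]; omega
      simp [trunc, this]
  | inv_of o h =>
    obtain ⟨M, hM⟩ := h
    exact ⟨M, fun N hN => by rw [map_inv, hM N hN]⟩
  | mul a b ha hb =>
    obtain ⟨M, hM⟩ := ha
    obtain ⟨M', hM'⟩ := hb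
    exact ⟨max M M', fun N hN => by
      rw [map_mul, hM N (le_trans (le_max_left _ _) hN), hM' N (le_trans (le_max_right _ _) hN)]⟩

/-- The `n`-th shift of the stem `y` is `r_{n-1}⁻¹ ⋯ r₀⁻¹ y`, with one copy of `r⁻¹` on each level
from `0` to `n - 1`. -/
theorem proj_shift_pow_stem (r : FreeGroup J) (i n : ℕ) :
    proj J i ((shift r ^ n) (stem J)) = if i < n then r⁻¹ else 1 := by
  induction n with
  | zero => simp
  | succ n ih =>
    rw [shift_pow_succ_stem, map_mul, map_inv, ih]
    rcases lt_trichotomy i n with h | rfl | h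
    · rw [proj_level_of_ne (by omega), if_pos h, if_pos (by omega)]; simp
    · simp
    · rw [proj_level_of_ne (by omega), if_neg (by omega), if_neg (by omega)]; simp

/-- No nontrivial element is conjugate to its image under a high power of the shift. -/
theorem eq_one_of_isConj_shift_pow {r : FreeGroup J} (hr : r ≠ 1)
    {a : FreeGroup (Option (J × ℤ))} {M : ℕ} (haM : trunc J M a = a) {n : ℕ}
    (hn : 2 * M + 2 ≤ n) (h : IsConj a ((shift r ^ n) a)) : a = 1 := by
  let e := stemExponent J
  -- Level `q` lies just above the window `[-M, M]` and below the shifted window, which starts at `M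
  -- + 2` or higher. As `q < n`, it sees only the `r⁻¹` contributed by each stem.
  obtain ⟨q, hq⟩ : ∃ q : ℕ, q = M + 1 := ⟨_, rfl⟩
  have hproj : (proj J q).comp ((shift r ^ n).toMonoidHom.comp (trunc J M)) =
      (zpowersHom _ r⁻¹).comp e := by
    refine hom_ext ?_ fun i j => ?_
    · simp [e, proj_shift_pow_stem, show q < n by omega]
    · rcases le_or_gt |i| (M : ℤ) with hi | hi
      · have : i + n ≠ q := by rw [abs_le] at hi; omega
        simp [e, trunc_level_of_le hi, shift_pow_level, proj_level_of_ne this]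
      · simp [e, trunc_level_of_lt hi]
  have hproj' : (proj J q).comp (trunc J M) = 1 := by
    refine hom_ext (by simp) fun i j => ?_
    rcases le_or_gt |i| (M : ℤ) with hi | hi
    · have : i ≠ q := by rw [abs_le] at hi; omega
      simp [trunc_level_of_le hi, proj_level_of_ne this]
    · simp [trunc_level_of_lt hi]
  -- The shifted levels leave the window, so the truncated image depends only on the stem exponent.
  -- Once that exponent vanishes, `a` is conjugate to `1`.
  have htrunc : (trunc J M).comp ((shift r ^ n).toMonoidHom.comp (trunc J M)) =
      (zpowersHom _ (trunc J M ((shift r ^ n) (stem J)))).comp e := by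
    refine hom_ext (by simp [e]) fun i j => ?_
    rcases le_or_gt |i| (M : ℤ) with hi | hi
    · have : (M : ℤ) < |i + n| := by rw [abs_le] at hi; rw [lt_abs]; omega
      simp [e, trunc_level_of_le hi, shift_pow_level, trunc_level_of_lt this]
    · simp [e, trunc_level_of_lt hi]
  have h1 := DFunLike.congr_fun hproj a
  have h2 := DFunLike.congr_fun hproj' a
  have h3 := DFunLike.congr_fun htrunc a
  simp only [MonoidHom.comp_apply, haM, MulEquiv.toMonoidHom_eq_coe, MonoidHom.coe_coe,
    zpowersHom_apply, MonoidHom.one_apply] at h1 h2 h3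
  have hc := (proj J q).map_isConj h
  rw [h1, h2, isConj_one_right] at hc
  have he : (e a).toAdd = 0 := by
    by_contra he
    exact hr (inv_eq_one.mp ((IsMulTorsionFree.zpow_eq_one_iff_left he).mp hc))
  have hc' := (trunc J M).map_isConj h
  rw [h3, haM, he, zpow_zero] at hc'
  exact isConj_one_left.mp hc'

/-! ### Centralizers in the mapping torus -/

/-- The semidirect product `F ⋊ ℤ` in which the generator of `ℤ` acts through `shift r`. -/
abbrev Torus (r : FreeGroup J) : Type _ :=
  FreeGroup (Option (J × ℤ)) ⋊[zpowersHom (MulAut (FreeGroup (Option (J × ℤ)))) (shift r)]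
    Multiplicative ℤ

theorem isConj_of_commute_inl {r : FreeGroup J} {x : Torus r}
    {a : FreeGroup (Option (J × ℤ))} (h : Commute x (SemidirectProduct.inl a)) :
    IsConj a ((shift r ^ x.right.toAdd) a) := by
  have := congrArg SemidirectProduct.left h.eq
  simp only [SemidirectProduct.mul_left, SemidirectProduct.left_inl, SemidirectProduct.right_inl,
    map_one, MulAut.one_apply, zpowersHom_apply] at this
  rw [isConj_iff]
  refine ⟨x.left⁻¹, ?_⟩
  rw [mul_assoc, inv_inv, ← this, inv_mul_cancel_left]

/-- An element outside the free factor commutes with no nontrivial element of the free factor. -/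
theorem eq_one_of_commute_inl {r : FreeGroup J} (hr : r ≠ 1) {x : Torus r} (hx : x.right ≠ 1)
    {a : FreeGroup (Option (J × ℤ))} (h : Commute x (SemidirectProduct.inl a)) : a = 1 := by
  obtain ⟨M, hM⟩ := exists_trunc_eq_self a
  have hk : x.right.toAdd ≠ 0 := fun h0 => hx (Multiplicative.toAdd.injective h0)
  -- Powers of `x` still commute with `a`. The sign in `p` makes the shift exponent positive, and
  -- its size clears the window.
  obtain ⟨p, n, hn, hp⟩ : ∃ (p : ℤ) (n : ℕ), 2 * M + 2 ≤ n ∧ p * x.right.toAdd = n := by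
    refine ⟨(2 * M + 2 : ℕ) * x.right.toAdd.sign, (2 * M + 2) * x.right.toAdd.natAbs,
      Nat.le_mul_of_pos_right _ (Int.natAbs_pos.mpr hk), ?_⟩
    rw [mul_assoc, Int.sign_mul_self_eq_abs, Int.abs_eq_natAbs, ← Nat.cast_mul]
  have hc := isConj_of_commute_inl (h.zpow_left p)
  have hright : (x ^ p).right.toAdd = n := by
    rw [← hp, ← SemidirectProduct.rightHom_eq_right, map_zpow, toAdd_zpow, smul_eq_mul]
  rw [hright, zpow_natCast] at hc
  exact eq_one_of_isConj_shift_pow hr (hM M le_rfl) hn hc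

theorem eq_inl_of_right_eq_one {r : FreeGroup J} {x : Torus r} (hx : x.right = 1) :
    x = SemidirectProduct.inl x.left := by
  ext <;> simp [hx]

/-- Both the quotient `ℤ` and the free kernel are torsion-free. -/
theorem eq_one_of_zpow_eq_one {r : FreeGroup J} {x : Torus r} {n : ℤ} (hn : n ≠ 0)
    (h : x ^ n = 1) : x = 1 := by
  have hx : x.right = 1 := by
    have := congrArg SemidirectProduct.rightHom h
    rw [map_zpow, map_one] at this
    exact (IsMulTorsionFree.zpow_eq_one_iff_left hn).mp this
  rw [eq_inl_of_right_eq_one hx] at h ⊢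
  rw [← map_zpow, map_eq_one_iff _ SemidirectProduct.inl_injective,
    IsMulTorsionFree.zpow_eq_one_iff_left hn] at h
  rw [h, map_one]

/-- If `x` lies in the free factor, so does its centralizer. If not, the centralizer meets the free
factor trivially and embeds in `ℤ`. -/
theorem isCyclic_centralizer {r : FreeGroup J} (hr : r ≠ 1) {x : Torus r} (hx : x ≠ 1) :
    IsCyclic (Subgroup.centralizer {x}) := by
  have hcomm (y : Subgroup.centralizer {x}) : Commute (y : Torus r) x :=
    Subgroup.mem_centralizer_singleton_iff.mp y.2
  by_cases hxr : x.right = 1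
  · obtain ⟨a, rfl⟩ : ∃ a, x = SemidirectProduct.inl a := ⟨_, eq_inl_of_right_eq_one hxr⟩
    have ha : a ≠ 1 := fun h => hx (by rw [h, map_one])
    have := FreeGroup.isCyclic_centralizer ha
    let f : Subgroup.centralizer {a} →*
        Subgroup.centralizer {(SemidirectProduct.inl a : Torus r)} :=
      (SemidirectProduct.inl.comp (Subgroup.subtype _)).codRestrict _ fun c => by
        rw [Subgroup.mem_centralizer_singleton_iff]
        simp only [MonoidHom.comp_apply, Subgroup.coe_subtype, ← map_mul]
        rw [Subgroup.mem_centralizer_singleton_iff.mp c.2]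
    refine isCyclic_of_surjective f fun y => ?_
    have hy : (y : Torus r).right = 1 := by
      by_contra hy
      exact ha (eq_one_of_commute_inl hr hy (hcomm y))
    refine ⟨⟨(y : Torus r).left, ?_⟩, Subtype.ext (eq_inl_of_right_eq_one hy).symm⟩
    have h := (hcomm y).eq
    rw [eq_inl_of_right_eq_one hy, ← map_mul, ← map_mul] at h
    exact Subgroup.mem_centralizer_singleton_iff.mpr (SemidirectProduct.inl_injective h)
  · refine isCyclic_of_injective (SemidirectProduct.rightHom.comp (Subgroup.subtype _))
      ((injective_iff_map_eq_one _).mpr fun y hy => Subtype.ext ?_)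
    have hy : (y : Torus r).right = 1 := hy
    have h := (hcomm y).symm
    rw [eq_inl_of_right_eq_one hy] at h
    change (y : Torus r) = 1
    rw [eq_inl_of_right_eq_one hy, eq_one_of_commute_inl hr hxr h, map_one]

end FreeMappingTorus

/-! ### Surface groups -/

namespace SurfaceGroup

/-- The inclusion of the letters of genus `n` as the last `2n` letters of genus `n + 1`. -/
def letterShift {n : ℕ} (j : Fin (2 * n)) : Fin (2 * (n + 1)) := ⟨j + 2, by omega⟩

/-- The first letter. -/
def letterZero (n : ℕ) : Fin (2 * (n + 1)) := ⟨0, by omega⟩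

/-- The second letter. -/
def letterOne (n : ℕ) : Fin (2 * (n + 1)) := ⟨1, by omega⟩

theorem letter_cases {n : ℕ} (k : Fin (2 * (n + 1))) :
    k = letterZero n ∨ k = letterOne n ∨ ∃ j, k = letterShift j := by
  obtain ⟨k, hk⟩ := k
  rcases k with _ | _ | k
  · exact Or.inl rfl
  · exact Or.inr (Or.inl rfl)
  · exact Or.inr (Or.inr ⟨⟨k, by omega⟩, rfl⟩)

/-- A function on the letters of genus `n + 1`, from its values on the first two and on the rest. -/
def letterElim {A : Type*} {n : ℕ} (a b : A) (f : Fin (2 * n) → A) (k : Fin (2 * (n + 1))) : A :=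
  if k.val = 0 then a else if k.val = 1 then b else
    -- The last `a` is a default that is never reached.
    if h : k.val - 2 < 2 * n then f ⟨k.val - 2, h⟩ else a

section letterElim

variable {A : Type*} {n : ℕ} (a b : A) (f : Fin (2 * n) → A)

@[simp] theorem letterElim_zero : letterElim a b f (letterZero n) = a := rfl

@[simp] theorem letterElim_one : letterElim a b f (letterOne n) = b := rfl

@[simp] theorem letterElim_shift (j : Fin (2 * n)) : letterElim a b f (letterShift j) = f j := by
  simp [letterElim, letterShift]

end letterElim

open FreeGroup in
theorem surfaceRelator_succ (n : ℕ) :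
    surfaceRelator (n + 1) =
      of (letterZero n) * of (letterOne n) * (of (letterZero n))⁻¹ * (of (letterOne n))⁻¹ *
        FreeGroup.map letterShift (surfaceRelator n) := by
  rw [surfaceRelator, List.ofFn_succ, List.prod_cons, surfaceRelator, map_list_prod, List.map_ofFn]
  congr 3

/-- Two noncommuting transpositions of three points, with the other letters sent to `1`, detect the
first commutator. -/
theorem surfaceRelator_ne_one {n : ℕ} (hn : n ≠ 0) : surfaceRelator n ≠ 1 := by
  obtain ⟨n, rfl⟩ := Nat.exists_eq_add_one_of_ne_zero hn
  rw [surfaceRelator_succ]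
  intro h
  have := congrArg (FreeGroup.lift (letterElim (Equiv.swap (0 : Fin 3) 1) (Equiv.swap 1 2) 1)) h
  have h1 : (FreeGroup.lift (letterElim (Equiv.swap (0 : Fin 3) 1) (Equiv.swap 1 2) 1)).comp
      (FreeGroup.map (letterShift (n := n))) = 1 := by ext1 j; simp
  have h2 := DFunLike.congr_fun h1 (surfaceRelator n)
  rw [MonoidHom.comp_apply, MonoidHom.one_apply] at h2
  simp only [map_mul, map_inv, FreeGroup.lift_apply_of, letterElim_zero, letterElim_one, h2,
    map_one] at this
  revert this
  decide

/-! ### Embedding the surface group in the mapping torus -/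

open FreeMappingTorus SemidirectProduct

/-- The homomorphism of the surface group of genus `n + 1` to `F ⋊ ℤ` that sends the first generator
to the generator of `ℤ`, the second one to the stem and the other ones to level `0`. -/
noncomputable def toTorus (n : ℕ) : SurfaceGroup (n + 1) →* Torus (surfaceRelator n) :=
  PresentedGroup.toGroup (f := letterElim (inr (Multiplicative.ofAdd 1)) (inl (stem _))
    fun j => inl (level _ 0 (FreeGroup.of j))) <| by
  rintro _ rfl
  rw [surfaceRelator_succ]
  have h : (FreeGroup.lift (letterElim (inr (Multiplicative.ofAdd 1)) (inl (stem _))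
      fun j => inl (level _ 0 (FreeGroup.of j)))).comp (FreeGroup.map (letterShift (n := n))) =
      (inl : _ →* Torus (surfaceRelator n)).comp (level _ 0) := by ext1 j; simp
  have h' := DFunLike.congr_fun h (surfaceRelator n)
  rw [MonoidHom.comp_apply, MonoidHom.comp_apply] at h'
  simp only [map_mul, map_inv, FreeGroup.lift_apply_of, letterElim_zero, letterElim_one, h']
  -- Conjugation by the generator of `ℤ` is the shift, so the first commutator becomes `r₀⁻¹` and
  -- cancels the rest of the relator.
  rw [← map_inv inr, ← inl_aut, zpowersHom_apply, toAdd_ofAdd, zpow_one, shift_stem]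
  simp [mul_assoc]

section ofTorus

variable (n : ℕ)

/-- The generator of the surface group with a given index. -/
abbrev gen {g : ℕ} (k : Fin (2 * g)) : SurfaceGroup g := PresentedGroup.of k

theorem relation_succ :
    gen (letterZero n) * gen (letterOne n) * (gen (letterZero n))⁻¹ * (gen (letterOne n))⁻¹ *
      FreeGroup.lift (fun j : Fin (2 * n) => gen (letterShift j)) (surfaceRelator n) = 1 := by
  have h : PresentedGroup.mk {surfaceRelator (n + 1)} _ = 1 :=
    PresentedGroup.one_of_mem (Set.mem_singleton_iff.mpr (surfaceRelator_succ n).symm)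
  have h1 : (PresentedGroup.mk {surfaceRelator (n + 1)}).comp (FreeGroup.map letterShift) =
      FreeGroup.lift (fun j : Fin (2 * n) => gen (letterShift j)) := by ext1 j; simp; rfl
  rw [map_mul] at h
  rw [← h1]
  exact h

/-- The homomorphism of the free factor to the surface group. -/
def ofFree : FreeGroup (Option (Fin (2 * n) × ℤ)) →* SurfaceGroup (n + 1) :=
  FreeGroup.lift fun o => o.elim (gen (letterOne n)) fun p =>
    gen (letterZero n) ^ p.2 * gen (letterShift p.1) * (gen (letterZero n) ^ p.2)⁻¹

@[simp] theorem ofFree_stem : ofFree n (stem _) = gen (letterOne n) := by simp [ofFree, stem]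

@[simp] theorem ofFree_level (i : ℤ) (j : Fin (2 * n)) : ofFree n (level _ i (FreeGroup.of j)) =
    gen (letterZero n) ^ i * gen (letterShift j) * (gen (letterZero n) ^ i)⁻¹ := by
  simp [ofFree, level]

/-- On the stem this is the surface relation. It is the compatibility needed to extend `ofFree` to
the semidirect product. -/
theorem ofFree_shift (a : FreeGroup (Option (Fin (2 * n) × ℤ))) :
    ofFree n (shift (surfaceRelator n) a) =
      gen (letterZero n) * ofFree n a * (gen (letterZero n))⁻¹ := by
  have h0 : (ofFree n).comp (level _ 0) =
      FreeGroup.lift (fun j : Fin (2 * n) => gen (letterShift j)) := by ext1 j; simp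
  have h0' := DFunLike.congr_fun h0 (surfaceRelator n)
  have h : (ofFree n).comp (shift (surfaceRelator n)).toMonoidHom =
      (MulAut.conj (gen (letterZero n))).toMonoidHom.comp (ofFree n) := by
    refine FreeMappingTorus.hom_ext ?_ fun i j => ?_
    · have hr := relation_succ n
      rw [← h0', MonoidHom.comp_apply, mul_eq_one_iff_inv_eq'] at hr
      simp [hr]
    · simp [add_comm i, zpow_add, mul_assoc]
  exact DFunLike.congr_fun h a

theorem ofFree_shift_zpow (k : ℤ) (a : FreeGroup (Option (Fin (2 * n) × ℤ))) :
    ofFree n ((shift (surfaceRelator n) ^ k) a) =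
      gen (letterZero n) ^ k * ofFree n a * (gen (letterZero n) ^ k)⁻¹ := by
  induction k generalizing a with
  | zero => simp
  | succ k ih =>
    rw [zpow_add_one, MulAut.mul_apply, ih, ofFree_shift, zpow_add_one]
    group
  | pred k ih =>
    have h := ofFree_shift n ((shift (surfaceRelator n))⁻¹ a)
    rw [MulAut.apply_inv_self] at h
    rw [zpow_sub_one, MulAut.mul_apply, ih, h, zpow_sub_one]
    group

/-- The inverse of `toTorus`. -/
def ofTorus : Torus (surfaceRelator n) →* SurfaceGroup (n + 1) :=
  SemidirectProduct.lift (ofFree n) (zpowersHom _ (gen (letterZero n))) fun k => by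
    ext1 o
    exact ofFree_shift_zpow n _ _

theorem toTorus_injective : Function.Injective (toTorus n) := by
  have h : (ofTorus n).comp (toTorus n) = MonoidHom.id _ := by
    refine PresentedGroup.ext fun k => ?_
    rw [MonoidHom.comp_apply, MonoidHom.id_apply, toTorus, PresentedGroup.toGroup.of]
    rcases letter_cases k with rfl | rfl | ⟨j, rfl⟩ <;> simp [ofTorus]
  exact Function.LeftInverse.injective (g := ofTorus n) (DFunLike.congr_fun h)

end ofTorus

theorem eq_one_of_zpow_eq_one {g : ℕ} (hg : g ≠ 0) {z : SurfaceGroup g} {n : ℤ} (hn : n ≠ 0)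
    (h : z ^ n = 1) : z = 1 := by
  obtain ⟨g, rfl⟩ := Nat.exists_eq_add_one_of_ne_zero hg
  rw [← map_eq_one_iff (toTorus g) (toTorus_injective g)] at h ⊢
  rw [map_zpow] at h
  exact FreeMappingTorus.eq_one_of_zpow_eq_one hn h

/-- The centralizer of a nontrivial element of a surface group of genus at least `2` is cyclic. -/
theorem isCyclic_centralizer {g : ℕ} (hg : 2 ≤ g) {w : SurfaceGroup g} (hw : w ≠ 1) :
    IsCyclic (Subgroup.centralizer {w}) := by
  obtain ⟨n, rfl⟩ : ∃ n, g = n + 1 := ⟨g - 1, by omega⟩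
  have hw' : toTorus n w ≠ 1 := (map_ne_one_iff _ (toTorus_injective n)).mpr hw
  have := FreeMappingTorus.isCyclic_centralizer (surfaceRelator_ne_one (by omega)) hw'
  let f : Subgroup.centralizer {w} →* Subgroup.centralizer {toTorus n w} :=
    ((toTorus n).comp (Subgroup.subtype _)).codRestrict _ fun c => by
      rw [Subgroup.mem_centralizer_singleton_iff]
      simp only [MonoidHom.comp_apply, Subgroup.coe_subtype, ← map_mul]
      rw [Subgroup.mem_centralizer_singleton_iff.mp c.2]
  refine isCyclic_of_injective f fun a b hab => Subtype.ext (toTorus_injective n ?_)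
  exact congrArg Subtype.val hab

/-- A generator of a nontrivial centralizer is not a proper power. -/
theorem exists_generator_centralizer {g : ℕ} (hg : 2 ≤ g) {w : SurfaceGroup g} (hw : w ≠ 1) :
    ∃ z : SurfaceGroup g, z ≠ 1 ∧ ¬ IsProperPower z ∧
      ∀ v, Commute v w → v ∈ Subgroup.zpowers z := by
  obtain ⟨⟨z, hz⟩, hgen⟩ := isCyclic_centralizer hg hw
  have hmem (v) (hv : Commute v w) : v ∈ Subgroup.zpowers z := by
    obtain ⟨k, hk⟩ := hgen ⟨v, Subgroup.mem_centralizer_singleton_iff.mpr hv⟩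
    exact ⟨k, congrArg Subtype.val hk⟩
  obtain ⟨p, hp⟩ := hmem w (Commute.refl w)
  have hz1 : z ≠ 1 := by
    rintro rfl
    exact hw (by simpa using hp.symm)
  refine ⟨z, hz1, ?_, hmem⟩
  rintro ⟨v, k, hk, hzv⟩
  have hvw : Commute v w := by
    rw [← hp, hzv]
    exact ((Commute.refl v).pow_right k).zpow_right p
  obtain ⟨j, hj⟩ := hmem v hvw
  -- From `z = v ^ k` and `v = z ^ j`, torsion-freeness forces `j * k = 1`, against `k ≥ 2`.
  have h : z ^ (j * k - 1) = 1 := by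
    simp only at hj
    rw [zpow_sub, zpow_mul, hj, zpow_natCast, ← hzv, zpow_one, mul_inv_cancel]
  refine hz1 (eq_one_of_zpow_eq_one (by omega) ?_ h)
  intro h0
  have := Int.eq_one_or_neg_one_of_mul_eq_one' (sub_eq_zero.mp h0)
  omega

end SurfaceGroup

/-! ### Homomorphisms to free abelian groups -/

/-- The target is commutative, so `f` factors through `surfaceAbHom`; it suffices to compare
generators. -/
theorem map_eq_sum_surfaceAb {g : ℕ} {A : Type*} [AddCommGroup A]
    (f : SurfaceGroup g →* Multiplicative A) (u : SurfaceGroup g) :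
    (f u).toAdd = ∑ i, surfaceAb u i • (f (PresentedGroup.of i)).toAdd := by
  let F : (Fin (2 * g) → ℤ) →+ A :=
    (Fintype.linearCombination ℤ fun i => (f (PresentedGroup.of i)).toAdd).toAddMonoidHom
  have h : f = (AddMonoidHom.toMultiplicative F).comp (surfaceAbHom g) := by
    refine PresentedGroup.ext fun i => ?_
    rw [MonoidHom.comp_apply, surfaceAbHom, PresentedGroup.toGroup.of]
    simp [F, Fintype.linearCombination_apply_single]
  have h' := congrArg Multiplicative.toAdd (DFunLike.congr_fun h u)
  exact h'

theorem map_eq_sum_pi {m : ℕ} {A : Type*} [AddCommGroup A]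
    (f : Multiplicative (Fin m → ℤ) →* Multiplicative A) (a : Fin m → ℤ) :
    (f (Multiplicative.ofAdd a)).toAdd =
      ∑ i, a i • (f (Multiplicative.ofAdd (Pi.single i 1))).toAdd := by
  let F : (Fin m → ℤ) →+ A := MonoidHom.toAdditive f
  have h : F.toIntLinearMap = Fintype.linearCombination ℤ fun i => F (Pi.single i 1) := by
    ext i; simp [Fintype.linearCombination_apply_single]
  exact DFunLike.congr_fun h a

open Matrix in
/-- A homomorphism from `π₁(Σ_g) × ℤ^m` to `ℤ^n` is linear in the exponent vectors. -/
theorem exists_matrices {g m n : ℕ}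
    (f : SurfaceTimesFreeAbelian g m →* Multiplicative (Fin n → ℤ)) :
    ∃ (Q : Matrix (Fin m) (Fin n) ℤ) (P : Matrix (Fin (2 * g)) (Fin n) ℤ),
      ∀ (u : SurfaceGroup g) (a : Fin m → ℤ),
        f (u, Multiplicative.ofAdd a) = Multiplicative.ofAdd (a ᵥ* Q + surfaceAb u ᵥ* P) := by
  refine ⟨fun i => (f (1, Multiplicative.ofAdd (Pi.single i 1))).toAdd,
    fun i => (f (PresentedGroup.of i, 1)).toAdd, fun u a => ?_⟩
  have hsplit : ((u, Multiplicative.ofAdd a) : SurfaceTimesFreeAbelian g m) =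
      (1, Multiplicative.ofAdd a) * (u, 1) := by simp
  have h1 := map_eq_sum_pi (f.comp (MonoidHom.inr _ _)) a
  have h2 := map_eq_sum_surfaceAb (f.comp (MonoidHom.inl _ _)) u
  simp only [MonoidHom.comp_apply, MonoidHom.inr_apply, MonoidHom.inl_apply] at h1 h2
  apply Multiplicative.toAdd.injective
  rw [hsplit, map_mul, toAdd_mul, h1, h2, toAdd_ofAdd]
  ext j
  simp [Matrix.vecMul, dotProduct]

open Matrix in
/-- A homomorphism from `π₁(Σ_g) × ℤ^m` to `ℤ` is linear in the exponent vectors. -/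
theorem exists_vectors {g m : ℕ} (f : SurfaceTimesFreeAbelian g m →* Multiplicative ℤ) :
    ∃ (l : Fin m → ℤ) (h : Fin (2 * g) → ℤ), ∀ (u : SurfaceGroup g) (a : Fin m → ℤ),
      f (u, Multiplicative.ofAdd a) = Multiplicative.ofAdd (a ⬝ᵥ l + surfaceAb u ⬝ᵥ h) := by
  refine ⟨fun i => (f (1, Multiplicative.ofAdd (Pi.single i 1))).toAdd,
    fun i => (f (PresentedGroup.of i, 1)).toAdd, fun u a => ?_⟩
  have hsplit : ((u, Multiplicative.ofAdd a) : SurfaceTimesFreeAbelian g m) =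
      (1, Multiplicative.ofAdd a) * (u, 1) := by simp
  have h1 := map_eq_sum_pi (f.comp (MonoidHom.inr _ _)) a
  have h2 := map_eq_sum_surfaceAb (f.comp (MonoidHom.inl _ _)) u
  simp only [MonoidHom.comp_apply, MonoidHom.inr_apply, MonoidHom.inl_apply] at h1 h2
  apply Multiplicative.toAdd.injective
  rw [hsplit, map_mul, toAdd_mul, h1, h2, toAdd_ofAdd]
  rfl

/-- A homomorphism into the powers of an element `z` of infinite order is `z` to a homomorphism
to `ℤ`. -/
theorem exists_exponent_hom {G H : Type*} [Group G] [Group H] {z : H}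
    (hz : ∀ n : ℤ, z ^ n = 1 → n = 0) (f : G →* H) (hf : ∀ x, f x ∈ Subgroup.zpowers z) :
    ∃ e : G →* Multiplicative ℤ, ∀ x, f x = z ^ (e x).toAdd := by
  have hinj : Function.Injective (zpowersHom H z) := by
    refine (injective_iff_map_eq_one _).mpr fun n hn => ?_
    exact Multiplicative.toAdd.injective (hz _ (by simpa using hn))
  choose e he using hf
  refine ⟨MonoidHom.mk' (fun x => Multiplicative.ofAdd (e x)) fun x y => hinj ?_,
    fun x => (he x).symm⟩
  have h := he (x * y)
  rw [map_mul, ← he x, ← he y] at h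
  simpa [zpow_add] using h

/-! ### The dichotomy for endomorphisms -/

open Matrix in
theorem mainTheorem11 (g m : ℕ) (hg : 2 ≤ g) (hm : 1 ≤ m)
    (Ψ : SurfaceTimesFreeAbelian g m →* SurfaceTimesFreeAbelian g m) :
    (∃ (φ : SurfaceGroup g →* SurfaceGroup g)
        (Q : Matrix (Fin m) (Fin m) ℤ) (P : Matrix (Fin (2 * g)) (Fin m) ℤ),
      ∀ (u : SurfaceGroup g) (a : Fin m → ℤ),
        Ψ (u, Multiplicative.ofAdd a) =
          (φ u, Multiplicative.ofAdd (a ᵥ* Q + surfaceAb u ᵥ* P))) ∨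
    (∃ (z : SurfaceGroup g) (l : Fin m → ℤ) (h : Fin (2 * g) → ℤ)
        (Q : Matrix (Fin m) (Fin m) ℤ) (P : Matrix (Fin (2 * g)) (Fin m) ℤ),
      z ≠ 1 ∧ ¬ IsProperPower z ∧ l ≠ 0 ∧
      ∀ (u : SurfaceGroup g) (a : Fin m → ℤ),
        Ψ (u, Multiplicative.ofAdd a) =
          (z ^ (a ⬝ᵥ l + surfaceAb u ⬝ᵥ h),
            Multiplicative.ofAdd (a ᵥ* Q + surfaceAb u ᵥ* P))) := by
  obtain ⟨Q, P, hQP⟩ := exists_matrices ((MonoidHom.snd _ _).comp Ψ)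
  by_cases htriv : ∀ a : Fin m → ℤ, (Ψ (1, Multiplicative.ofAdd a)).1 = 1
  · refine Or.inl ⟨(MonoidHom.fst _ _).comp (Ψ.comp (MonoidHom.inl _ _)), Q, P, fun u a => ?_⟩
    refine Prod.ext ?_ (hQP u a)
    have hsplit : ((u, Multiplicative.ofAdd a) : SurfaceTimesFreeAbelian g m) =
        (1, Multiplicative.ofAdd a) * (u, 1) := by simp
    rw [hsplit, map_mul, Prod.fst_mul, htriv, one_mul]
    rfl
  · push Not at htriv
    obtain ⟨a₀, ha₀⟩ := htriv
    obtain ⟨z, hz1, hzpow, hz⟩ := SurfaceGroup.exists_generator_centralizer hg ha₀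
    have hcomm (x) : Commute (Ψ x).1 (Ψ (1, Multiplicative.ofAdd a₀)).1 := by
      have : Commute x (1, Multiplicative.ofAdd a₀) :=
        Prod.ext (by simp) (mul_comm _ _)
      exact (this.map Ψ).map (MonoidHom.fst _ _)
    have hord (n : ℤ) (hn : z ^ n = 1) : n = 0 := by
      by_contra h0
      exact hz1 (SurfaceGroup.eq_one_of_zpow_eq_one (by omega) h0 hn)
    obtain ⟨e, he⟩ := exists_exponent_hom hord ((MonoidHom.fst _ _).comp Ψ)
      fun x => hz _ (hcomm x)
    obtain ⟨l, h, hlh⟩ := exists_vectors e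
    have hfst (u : SurfaceGroup g) (a : Fin m → ℤ) : (Ψ (u, Multiplicative.ofAdd a)).1 =
        z ^ (a ⬝ᵥ l + surfaceAb u ⬝ᵥ h) := by
      have := he (u, Multiplicative.ofAdd a)
      rwa [hlh] at this
    refine Or.inr ⟨z, l, h, Q, P, hz1, hzpow, ?_, fun u a => Prod.ext (hfst u a) (hQP u a)⟩
    -- With `l = 0` the exponent of `z` at `(1, a₀)` would vanish, contradicting the choice of `a₀`.
    rintro rfl
    refine ha₀ ?_
    rw [hfst]
    simp [surfaceAb]
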